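/- Theorem. A CSS code on $n$ qubits is given by binary parity-check matrices $H_X\in\mathbb F_2^{n_X\times n}$ and $H_Z\in\mathbb F_2^{n_Z\times n}$ with $H_XH_Z^T=0$, whose rows are the $X$-type and $Z$-type stabilizer generators; equivalently, by a chain complex $C_{k+1}=\mathbb F_2^{n_Z}\to C_k=\mathbb F_2^{n}\to C_{k-1}=\mathbb F_2^{n_X}$ with $\partial_{k+1}=H_Z^T$, $\partial_k=H_X$, and $\delta^{k-1}=H_X^T$. Its distance $d$ is the minimal weight of a nontrivial logical Pauli operator ($d=\infty$ if there is none), and a code state is a unit vector fixed by all stabilizer generators. Consider a family of CSS codes that is quantum LDPC: all stabilizer generators of all codes have weight at most a constant $s$. Below, $O(1)$, $\omega(1)$ and $O(m)$ refer to the limit of the number $n$ of physical qubits tending to infinity along the family, and $|\cdot|$ is the Hamming weight. Suppose that $d=\omega(1)$ and that the family has (a) weak systolic expansion: for every choice of chains $f\in C_{k+1}$ (one for each code), if $\min_{z\in\ker\partial_{k+1}}|f+z|=\omega(1)$, then $|\partial_{k+1}f|=\omega(1)$; (b) weak cosystolic expansion: for every choice of cochains $f\in C^{k-1}=\mathbb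 F_2^{n_X}$ (one for each code), if $\min_{z\in\ker\delta^{k-1}}|f+z|=\omega(1)$, then $|\delta^{k-1}f|=\omega(1)$. Let $K=O(1)$. Then for every $K$-local Hamiltonian $\hat H=\sum_{j=1}^m\hat H_j$ on the $n$ qubits, meaning that each $\hat H_j$ is Hermitian with $\|\hat H_j\|\le 1$ and acts nontrivially on at most $K$ qubits, and that each qubit is acted on nontrivially by at most $K$ of the terms $\hat H_j$, and for every code state $|\psi\rangle$, the quantum Fisher information satisfies $$\mathcal F(|\psi\rangle,\hat H)=\langle\psi|\hat H^2|\psi\rangle-|\langle\psi|\hat H|\psi\rangle|^2=O(m),$$ where the implied constant depends only on the family of codes and on $K$, not on $\hat H$, $m$ or $|\psi\rangle$. -/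

import Mathlib

open Filter Matrix

/-! ## Qubits, Pauli operators, supports

The computational basis of `n` qubits is indexed by bit strings `Fin n → ZMod 2`. -/

/-- Bit strings of length `n`, which are also the `𝔽₂`-chains on `n` cells. -/
abbrev Bits (n : ℕ) : Type := Fin n → ZMod 2

/-- State vectors of `n` qubits. -/
abbrev QState (n : ℕ) : Type := EuclideanSpace ℂ (Bits n)

/-- Operators on `n` qubits, as matrices in the computational basis. -/
abbrev QOp (n : ℕ) : Type := Matrix (Bits n) (Bits n) ℂ

/-- The operator of a matrix, acting on the Hilbert space of `n` qubits. -/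
noncomputable def QOp.toCLM {n : ℕ} (O : QOp n) : QState n →L[ℂ] QState n :=
  Matrix.toEuclideanCLM (𝕜 := ℂ) O

/-- The Pauli operator `X^a`, which maps the basis vector `|y⟩` to `|y + a⟩`. -/
def pauliX {n : ℕ} (a : Bits n) : QOp n :=
  Matrix.of fun x y => if x = y + a then 1 else 0

/-- The Pauli operator `Z^b`, which maps the basis vector `|x⟩` to `(-1)^(b·x) |x⟩`. -/
def pauliZ {n : ℕ} (b : Bits n) : QOp n :=
  Matrix.diagonal fun x => (-1) ^ (b ⬝ᵥ x).val

/-- `O = O_A ⊗ 𝕀` for some operator `O_A` on the qubits in `A`. -/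
def QOp.IsSupportedOn {n : ℕ} (O : QOp n) (A : Finset (Fin n)) : Prop :=
  ∃ OA : Matrix (A → ZMod 2) (A → ZMod 2) ℂ, ∀ x y : Bits n,
    ((∀ i, i ∉ A → x i = y i) → O x y = OA (fun i => x i) (fun i => y i)) ∧
    ((∃ i, i ∉ A ∧ x i ≠ y i) → O x y = 0)

open Classical in
/-- The support of `O`: the qubits on which `O` acts nontrivially, that is, those qubits `i`
for which `O` is not of the form `O' ⊗ 𝕀` with `𝕀` on qubit `i`. -/
noncomputable def QOp.supp {n : ℕ} (O : QOp n) : Finset (Fin n) :=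
  Finset.univ.filter fun i => ¬ O.IsSupportedOn (Finset.univ.erase i)

/-! ## Local Hamiltonians and quantum Fisher information -/

/-- A `K`-local Hamiltonian `∑_{j=1}^m H_j` on `n` qubits: each term is Hermitian of operator
norm at most `1`, acts on at most `K` qubits, and each qubit is acted on by at most `K` of the
terms (counted with multiplicity). -/
structure LocalHamiltonian (n m K : ℕ) where
  /-- the terms `H_j` -/
  term : Fin m → QOp n
  isHermitian : ∀ j, (term j).IsHermitian
  norm_le_one : ∀ j, ‖(term j).toCLM‖ ≤ 1
  card_supp_le : ∀ j, (term j).supp.card ≤ K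
  degree_le : ∀ i : Fin n, {j : Fin m | i ∈ (term j).supp}.ncard ≤ K

/-- The Hamiltonian `H = ∑_j H_j` itself. -/
noncomputable def LocalHamiltonian.total {n m K : ℕ} (H : LocalHamiltonian n m K) : QOp n :=
  ∑ j, H.term j

/-- The quantum Fisher information of a pure state `ψ` for the evolution `exp (-i θ H / 2)`:
`⟨ψ|H²|ψ⟩ - |⟨ψ|H|ψ⟩|²`. -/
noncomputable def qfi {n : ℕ} (ψ : QState n) (H : QOp n) : ℝ :=
  (inner ℂ ψ (QOp.toCLM (H * H) ψ)).re - ‖inner ℂ ψ (H.toCLM ψ)‖ ^ 2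

/-! ## CSS codes -/

/-- A CSS code given by its parity-check matrices; the rows of `hX` are the `X`-type stabilizer
generators and the rows of `hZ` are the `Z`-type ones. Equivalently, a chain complex
`C_{k+1} → C_k → C_{k-1}` over `𝔽₂` with `Z`-checks, qubits and `X`-checks as its cells, boundary
maps `∂_{k+1} = hZᵀ` and `∂_k = hX`, and coboundary map `δ^{k-1} = hXᵀ`. -/
structure CSSCode where
  /-- number of physical qubits -/
  n : ℕ
  /-- number of `X`-type generators -/
  nX : ℕ
  /-- number of `Z`-type generators -/
  nZ : ℕ
  hX : Matrix (Fin nX) (Fin n) (ZMod 2)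
  hZ : Matrix (Fin nZ) (Fin n) (ZMod 2)
  comm : hX * hZᵀ = 0

namespace CSSCode

/-- All stabilizer generators have weight at most `s`. -/
def IsLDPC (C : CSSCode) (s : ℕ) : Prop :=
  (∀ j, hammingNorm (C.hX j) ≤ s) ∧ (∀ j, hammingNorm (C.hZ j) ≤ s)

/-- A code state: a unit vector fixed by all stabilizer generators. -/
def IsCodeState (C : CSSCode) (ψ : QState C.n) : Prop :=
  ‖ψ‖ = 1 ∧ (∀ j, (pauliX (C.hX j)).toCLM ψ = ψ) ∧ (∀ j, (pauliZ (C.hZ j)).toCLM ψ = ψ)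

/-- `X^a Z^b` is a nontrivial logical operator: it commutes with all stabilizer generators, and
it is not, up to a phase, a product of stabilizer generators. -/
def IsNontrivialLogical (C : CSSCode) (a b : Bits C.n) : Prop :=
  C.hZ *ᵥ a = 0 ∧ C.hX *ᵥ b = 0 ∧
    ¬ ((∃ u, a = C.hXᵀ *ᵥ u) ∧ (∃ v, b = C.hZᵀ *ᵥ v))

/-- The code distance: the minimal weight (number of qubits acted on) of a nontrivial logical
Pauli operator; it is `⊤` if there is none (no encoded qubit). -/
noncomputable def distance (C : CSSCode) : ℕ∞ :=
  ⨅ (a : Bits C.n) (b : Bits C.n) (_ : C.IsNontrivialLogical a b),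
    ((Finset.univ.filter fun i => a i ≠ 0 ∨ b i ≠ 0).card : ℕ∞)

end CSSCode

/-! ## Asymptotics and weak expansion -/

/-- The limit `n → ∞` along a family of codes, `n` being the number of physical qubits.
A quantity `g` is `ω(1)` with respect to `n` if it tends to infinity along this filter. -/
def manyQubits {ι : Type*} (𝒞 : ι → CSSCode) : Filter ι :=
  Filter.comap (fun i => (𝒞 i).n) atTop

/-- `min_{z ∈ ker M} |f + z|`, with `|·|` the Hamming weight. -/
noncomputable def minCosetWeight {a b : ℕ} (M : Matrix (Fin a) (Fin b) (ZMod 2)) (f : Bits b) :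
    ℕ :=
  sInf {w | ∃ z : Bits b, M *ᵥ z = 0 ∧ hammingNorm (f + z) = w}

/-- Weak systolic expansion: for chains `f ∈ C_{k+1}`, whenever `min_{z ∈ Z_{k+1}} |f + z|` is
`ω(1)`, so is `|∂_{k+1} f|`. -/
def WeakSystolicExpansion {ι : Type*} (𝒞 : ι → CSSCode) : Prop :=
  ∀ f : (i : ι) → Bits (𝒞 i).nZ,
    Tendsto (fun i => minCosetWeight (𝒞 i).hZᵀ (f i)) (manyQubits 𝒞) atTop →
    Tendsto (fun i => hammingNorm ((𝒞 i).hZᵀ *ᵥ f i)) (manyQubits 𝒞) atTop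

/-- Weak cosystolic expansion: for cochains `f ∈ C^{k-1}`, whenever `min_{z ∈ Z^{k-1}} |f + z|`
is `ω(1)`, so is `|δ^{k-1} f|`. -/
def WeakCosystolicExpansion {ι : Type*} (𝒞 : ι → CSSCode) : Prop :=
  ∀ f : (i : ι) → Bits (𝒞 i).nX,
    Tendsto (fun i => minCosetWeight (𝒞 i).hXᵀ (f i)) (manyQubits 𝒞) atTop →
    Tendsto (fun i => hammingNorm ((𝒞 i).hXᵀ *ᵥ f i)) (manyQubits 𝒞) atTop

/-! The quantum Fisher information is the sum of the covariances of all pairs of terms, so a linear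
bound follows if each term is correlated with boundedly many others. Once the distance exceeds `K`,
expand a term in the Pauli operators on its support, at most `4 ^ K` of them. None is a nontrivial
logical operator, so each either fixes the code state up to a phase or anticommutes with some
generator `g`. In the second case `g` makes `Pψ` orthogonal to `Oψ` for every `O` avoiding the
support of `g`. Hence a term can correlate only with terms meeting a set of at most `4 ^ K * s`
qubits (`CSSCode.exists_finset_inner_eq_zero`). At most `K` terms touch each qubit, and each
covariance is at most `2`. -/

namespace QOp

variable {n : ℕ}

/-! ## Pauli operators -/

theorem neg_one_pow_val_add (s t : ZMod 2) :
    (-1 : ℂ) ^ (s + t).val = (-1) ^ s.val * (-1) ^ t.val := by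
  rw [← pow_add, ZMod.val_add, neg_one_pow_eq_pow_mod_two (n := s.val + t.val)]

theorem bits_add_self (a : Bits n) : a + a = 0 := by
  funext i; exact CharTwo.add_self_eq_zero (a i)

theorem eq_add_iff_eq_add (x y a : Bits n) : x = y + a ↔ y = x + a := by
  constructor <;> rintro rfl <;> rw [add_assoc, bits_add_self, add_zero]

theorem pauliX_mul_apply (a : Bits n) (O : QOp n) (x y : Bits n) :
    (pauliX a * O) x y = O (x + a) y := by
  simp [pauliX, Matrix.mul_apply, eq_add_iff_eq_add x]

theorem mul_pauliX_apply (a : Bits n) (O : QOp n) (x y : Bits n) :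
    (O * pauliX a) x y = O x (y + a) := by
  simp [pauliX, Matrix.mul_apply]

theorem pauliZ_mul_apply (b : Bits n) (O : QOp n) (x y : Bits n) :
    (pauliZ b * O) x y = (-1) ^ (b ⬝ᵥ x).val * O x y := by
  simp [pauliZ]

theorem mul_pauliZ_apply (b : Bits n) (O : QOp n) (x y : Bits n) :
    (O * pauliZ b) x y = O x y * (-1) ^ (b ⬝ᵥ y).val := by
  simp [pauliZ]

theorem pauliX_zero : pauliX (0 : Bits n) = 1 := by
  ext x y; simp [pauliX, Matrix.one_apply]

theorem pauliZ_zero : pauliZ (0 : Bits n) = 1 := by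
  ext x y; simp [pauliZ]

theorem pauliX_add (a a' : Bits n) : pauliX (a + a') = pauliX a * pauliX a' := by
  ext x y
  rw [pauliX_mul_apply]
  simp only [pauliX, Matrix.of_apply]
  refine if_congr ?_ rfl rfl
  rw [eq_add_iff_eq_add x, eq_add_iff_eq_add (x + a), add_assoc]

theorem pauliZ_add (b b' : Bits n) : pauliZ (b + b') = pauliZ b * pauliZ b' := by
  simp [pauliZ, add_dotProduct, neg_one_pow_val_add]

theorem isHermitian_pauliX (a : Bits n) : (pauliX a).IsHermitian := by
  ext x y
  simp only [pauliX, Matrix.conjTranspose_apply, Matrix.of_apply, apply_ite star, star_one,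
    star_zero]
  exact if_congr (eq_add_iff_eq_add y x a) rfl rfl

theorem isHermitian_pauliZ (b : Bits n) : (pauliZ b).IsHermitian := by
  refine Matrix.isHermitian_diagonal_of_self_adjoint _ ?_
  funext x; simp

/-- `Z^b` and `X^a` commute up to the sign `(-1)^(b·a)`. -/
theorem pauliZ_mul_pauliX (a b : Bits n) :
    pauliZ b * pauliX a = (-1 : ℂ) ^ (b ⬝ᵥ a).val • (pauliX a * pauliZ b) := by
  ext x y
  rw [pauliZ_mul_apply, Matrix.smul_apply, mul_pauliZ_apply]
  by_cases h : x = y + a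
  · subst h
    simp [pauliX, dotProduct_add, neg_one_pow_val_add, mul_comm]
  · simp [pauliX, h]

/-! ## Operators and their supports -/

theorem eq_zero_of_notMem_supp {O : QOp n} {i : Fin n} (hi : i ∉ O.supp) {x y : Bits n}
    (h : x i ≠ y i) : O x y = 0 := by
  obtain ⟨OA, hO⟩ : O.IsSupportedOn (Finset.univ.erase i) := by simpa [supp] using hi
  exact (hO x y).2 ⟨i, by simp, h⟩

theorem apply_add_single_of_notMem_supp {O : QOp n} {i : Fin n} (hi : i ∉ O.supp) (t : ZMod 2)
    (x y : Bits n) : O (x + Pi.single i t) (y + Pi.single i t) = O x y := by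
  by_cases h : x i = y i
  · obtain ⟨OA, hO⟩ : O.IsSupportedOn (Finset.univ.erase i) := by simpa [supp] using hi
    rw [(hO x y).1 (by simpa using h), (hO _ _).1 (by simpa using h)]
    congr 1 <;>
    · funext j
      have hj : (j : Fin n) ≠ i := Finset.ne_of_mem_erase j.2
      simp [hj]
  · rw [eq_zero_of_notMem_supp hi h, eq_zero_of_notMem_supp hi (by simpa using h)]

/-- The support is defined one qubit at a time; flipping the qubits of `e` one by one yields the
joint invariance without building a reduced operator. -/
theorem apply_add_of_vanishing {O : QOp n} {e : Bits n} (he : ∀ i ∈ O.supp, e i = 0)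
    (x y : Bits n) : O (x + e) (y + e) = O x y := by
  have key : ∀ S : Finset (Fin n), ∀ x y : Bits n,
      O (x + ∑ i ∈ S, Pi.single i (e i)) (y + ∑ i ∈ S, Pi.single i (e i)) = O x y := by
    intro S
    induction S using Finset.induction_on with
    | empty => simp
    | insert i S hi ih =>
      intro x y
      rw [Finset.sum_insert hi, ← add_assoc, ← add_assoc, ih]
      by_cases h : i ∈ O.supp
      · simp [he i h]
      · exact apply_add_single_of_notMem_supp h _ x y
  simpa [Finset.univ_sum_single] using key Finset.univ x y

theorem commute_pauliX {O : QOp n} {e : Bits n} (he : ∀ i ∈ O.supp, e i = 0) :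
    pauliX e * O = O * pauliX e := by
  ext x y
  rw [pauliX_mul_apply, mul_pauliX_apply, ← apply_add_of_vanishing he x (y + e), add_assoc y,
    bits_add_self, add_zero]

theorem commute_pauliZ {O : QOp n} {e : Bits n} (he : ∀ i ∈ O.supp, e i = 0) :
    pauliZ e * O = O * pauliZ e := by
  ext x y
  rw [pauliZ_mul_apply, mul_pauliZ_apply]
  by_cases h : ∀ i ∉ O.supp, x i = y i
  · have : e ⬝ᵥ x = e ⬝ᵥ y := by
      refine Finset.sum_congr rfl fun i _ => ?_
      by_cases hi : i ∈ O.supp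
      · simp [he i hi]
      · rw [h i hi]
    rw [this, mul_comm]
  · push Not at h
    obtain ⟨i, hi, hxy⟩ := h
    simp [eq_zero_of_notMem_supp hi hxy]

theorem supp_one : (1 : QOp n).supp = ∅ := by
  rw [Finset.eq_empty_iff_forall_notMem]
  intro i hi
  simp only [supp, Finset.mem_filter, Finset.mem_univ, true_and] at hi
  refine hi ⟨1, fun x y => ⟨fun h => ?_, ?_⟩⟩
  · simp only [Matrix.one_apply]
    refine if_congr ⟨fun hxy => by rw [hxy], fun hxy => funext fun j => ?_⟩ rfl rfl
    by_cases hj : j ∈ Finset.univ.erase i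
    · exact congrFun hxy ⟨j, hj⟩
    · exact h j hj
  · rintro ⟨j, -, hj⟩
    exact Matrix.one_apply_ne fun hxy => hj (by rw [hxy])

/-! ## Expansion in Pauli operators -/

/-- The bit string that is `1` exactly on `S`. -/
def indicatorBits (S : Finset (Fin n)) : Bits n := fun i => if i ∈ S then 1 else 0

/-- The restriction of a bit string to `A`, extended by zero. -/
def restrictBits (A : Finset (Fin n)) (y : Bits n) : Bits n := fun i => if i ∈ A then y i else 0

theorem neg_one_pow_indicatorBits_dotProduct (S : Finset (Fin n)) (x : Bits n) :
    (-1 : ℂ) ^ (indicatorBits S ⬝ᵥ x).val = ∏ i ∈ S, (-1 : ℂ) ^ (x i).val := by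
  have h : indicatorBits S ⬝ᵥ x = ∑ i ∈ S, x i := by
    simp [indicatorBits, dotProduct]
  rw [h]
  induction S using Finset.induction_on with
  | empty => simp
  | insert i S hi ih =>
    rw [Finset.sum_insert hi, Finset.prod_insert hi, neg_one_pow_val_add, ih]
    simp [indicatorBits, dotProduct]

/-- Orthogonality of characters: the sum factors as the product over `A` of `1 + (-1)^(x i)`, whose
factors are `2` or `0`. -/
theorem sum_powerset_neg_one_pow (A : Finset (Fin n)) (x : Bits n) :
    ∑ S ∈ A.powerset, (-1 : ℂ) ^ (indicatorBits S ⬝ᵥ x).val =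
      if ∀ i ∈ A, x i = 0 then 2 ^ A.card else 0 := by
  simp_rw [neg_one_pow_indicatorBits_dotProduct]
  rw [← Finset.prod_one_add]
  split_ifs with h
  · rw [Finset.prod_congr rfl (g := fun _ => (2 : ℂ)), Finset.prod_const]
    intro i hi
    rw [h i hi]
    norm_num
  · push Not at h
    obtain ⟨i, hi, hx⟩ := h
    refine Finset.prod_eq_zero hi ?_
    have : x i = 1 := by
      generalize x i = t at hx
      revert t; decide
    rw [this]
    simp [ZMod.val_one]

/-- Only the set where `x` and `y` differ can contribute, and it lies in `A` exactly when they agree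
off `A`. -/
theorem sum_powerset_ite_indicatorBits (A : Finset (Fin n)) (x y : Bits n) (f : Bits n → ℂ) :
    ∑ S ∈ A.powerset, (if x = y + indicatorBits S then f (indicatorBits S) else 0) =
      if ∀ i ∉ A, x i = y i then f (x + y) else 0 := by
  have hiff : ∀ S, x = y + indicatorBits S ↔ indicatorBits S = x + y := by
    intro S
    rw [add_comm y, eq_add_iff_eq_add]
  simp_rw [hiff]
  split_ifs with h
  · have hS : indicatorBits (Finset.univ.filter fun i => (x + y) i ≠ 0) = x + y := by
      funext i
      simp only [indicatorBits, Finset.mem_filter, Finset.mem_univ, true_and]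
      generalize (x + y) i = t
      revert t; decide
    rw [Finset.sum_eq_single (Finset.univ.filter fun i => (x + y) i ≠ 0)]
    · rw [if_pos hS, hS]
    · intro S _ hne
      refine if_neg fun hS' => hne ?_
      ext i
      have := congrFun hS' i
      simp only [Finset.mem_filter, Finset.mem_univ, true_and, ← this]
      simp [indicatorBits]
    · intro hmem
      refine absurd (Finset.mem_powerset.2 fun i hi => ?_) hmem
      by_contra hiA
      refine (Finset.mem_filter.1 hi).2 ?_
      rw [Pi.add_apply, h i hiA, CharTwo.add_self_eq_zero]
  · refine Finset.sum_eq_zero fun S hS => if_neg fun hS' => h fun i hi => ?_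
    have := congrFun hS' i
    have hiS : i ∉ S := fun hiS => hi (Finset.mem_powerset.1 hS hiS)
    simp only [indicatorBits, hiS, if_false, Pi.add_apply] at this
    exact CharTwo.add_eq_zero.1 this.symm

/-- An operator is a linear combination of the Pauli operators on its support. -/
theorem exists_eq_sum_pauli (O : QOp n) :
    ∃ c : Finset (Fin n) × Finset (Fin n) → ℂ,
      O = ∑ p ∈ O.supp.powerset ×ˢ O.supp.powerset,
        c p • (pauliX (indicatorBits p.1) * pauliZ (indicatorBits p.2)) := by
  set A := O.supp with hA
  let z : Finset (Fin n) → Bits n := indicatorBits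
  -- The Hilbert–Schmidt coefficient: the normalized trace over `A` of the adjoint Pauli times `O`,
  -- the other qubits being set to zero.
  refine ⟨fun p => ((2 : ℂ) ^ A.card)⁻¹ * ∑ R ∈ A.powerset,
    O (z R + z p.1) (z R) * (-1) ^ (z p.2 ⬝ᵥ z R).val, ?_⟩
  ext x y
  -- Fourier inversion on `A`: summing over `T` selects the `R` that agrees with `y` on `A`.
  -- Shifting both indices by `z R + y`, which vanishes on `A`, then restores `y` off `A`.
  have hterm : ∀ a : Bits n, ∑ T ∈ A.powerset,
      (((2 : ℂ) ^ A.card)⁻¹ * ∑ R ∈ A.powerset,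
        O (z R + a) (z R) * (-1) ^ (z T ⬝ᵥ z R).val) * (-1) ^ (z T ⬝ᵥ y).val =
      O (y + a) y := by
    intro a
    have h1 : ∀ T, (((2 : ℂ) ^ A.card)⁻¹ * ∑ R ∈ A.powerset,
        O (z R + a) (z R) * (-1) ^ (z T ⬝ᵥ z R).val) * (-1) ^ (z T ⬝ᵥ y).val =
        ∑ R ∈ A.powerset, ((2 : ℂ) ^ A.card)⁻¹ * O (z R + a) (z R) *
          (-1) ^ (z T ⬝ᵥ (z R + y)).val := by
      intro T
      rw [Finset.mul_sum, Finset.sum_mul]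
      refine Finset.sum_congr rfl fun R _ => ?_
      rw [dotProduct_add, neg_one_pow_val_add]
      ring
    simp_rw [h1]
    rw [Finset.sum_comm]
    simp_rw [← Finset.mul_sum]
    have h2 : ∀ R ∈ A.powerset, ((2 : ℂ) ^ A.card)⁻¹ * O (z R + a) (z R) *
        ∑ T ∈ A.powerset, (-1 : ℂ) ^ (z T ⬝ᵥ (z R + y)).val =
        if restrictBits A y = 0 + z R then O (y + a) y else 0 := by
      intro R hR
      rw [sum_powerset_neg_one_pow]
      have hiff : (∀ i ∈ A, (z R + y) i = 0) ↔ restrictBits A y = 0 + z R := by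
        rw [zero_add]
        constructor
        · intro h
          funext i
          by_cases hi : i ∈ A
          · simp only [restrictBits, hi, if_true]
            exact (CharTwo.add_eq_zero.1 (h i hi)).symm
          · have hiR : i ∉ R := fun h' => hi (Finset.mem_powerset.1 hR h')
            simp [restrictBits, hi, z, indicatorBits, hiR]
        · intro h i hi
          rw [Pi.add_apply, ← h]
          simp only [restrictBits, hi, if_true]
          exact CharTwo.add_self_eq_zero _
      by_cases h : ∀ i ∈ A, (z R + y) i = 0
      · rw [if_pos h, if_pos (hiff.1 h), mul_right_comm, inv_mul_cancel₀ (pow_ne_zero _ two_ne_zero), one_mul,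
          ← apply_add_of_vanishing (e := z R + y) h (z R + a) (z R)]
        congr 1
        · rw [show z R + a + (z R + y) = (z R + z R) + (y + a) by abel, bits_add_self, zero_add]
        · rw [← add_assoc, bits_add_self, zero_add]
      · rw [if_neg h, if_neg fun h' => h (hiff.2 h'), mul_zero]
    rw [Finset.sum_congr rfl h2]
    -- Exactly one `R` matches the restriction of `y`; base point `0` explains the `0 + z R` above.
    have h3 := sum_powerset_ite_indicatorBits A (restrictBits A y) 0 fun _ => O (y + a) y
    refine h3.trans (if_pos fun i hi => ?_)
    simp [restrictBits, hi]
  rw [Finset.sum_product, Matrix.sum_apply]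
  have hS : ∀ S, (∑ T ∈ A.powerset, (((2 : ℂ) ^ A.card)⁻¹ * ∑ R ∈ A.powerset,
      O (z R + z S) (z R) * (-1) ^ (z T ⬝ᵥ z R).val) •
        (pauliX (indicatorBits S) * pauliZ (indicatorBits T))) x y =
      if x = y + indicatorBits S then O (y + indicatorBits S) y else 0 := by
    intro S
    rw [Matrix.sum_apply]
    simp_rw [Matrix.smul_apply, mul_pauliZ_apply, pauliX, Matrix.of_apply]
    split_ifs with h
    · simp only [one_mul, smul_eq_mul]
      exact hterm (z S)
    · simp
  simp_rw [hS]
  rw [sum_powerset_ite_indicatorBits A x y fun a => O (y + a) y]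
  split_ifs with h
  · rw [show y + (x + y) = x + (y + y) by abel, bits_add_self, add_zero]
  · push Not at h
    obtain ⟨i, hi, hxy⟩ := h
    exact eq_zero_of_notMem_supp hi hxy

/-! ## The action on states -/

theorem toCLM_mul_apply (O P : QOp n) (ψ : QState n) :
    QOp.toCLM (O * P) ψ = O.toCLM (P.toCLM ψ) := by
  simp [toCLM]

theorem toCLM_one_apply (ψ : QState n) : (1 : QOp n).toCLM ψ = ψ := by
  simp [toCLM]

theorem toCLM_sum_apply {κ : Type*} (S : Finset κ) (O : κ → QOp n) (ψ : QState n) :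
    (∑ p ∈ S, O p).toCLM ψ = ∑ p ∈ S, (O p).toCLM ψ := by
  simp [toCLM]

theorem toCLM_smul_apply (c : ℂ) (O : QOp n) (ψ : QState n) :
    (c • O).toCLM ψ = c • O.toCLM ψ := by
  simp [toCLM]

theorem inner_toCLM_of_isHermitian {O : QOp n} (hO : O.IsHermitian) (φ ψ : QState n) :
    inner ℂ (O.toCLM φ) ψ = inner ℂ φ (O.toCLM ψ) := by
  have h : star O.toCLM = O.toCLM := by
    rw [toCLM, ← map_star, Matrix.star_eq_conjTranspose, hO.eq]
  rw [ContinuousLinearMap.star_eq_adjoint] at h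
  nth_rewrite 1 [← h]
  exact ContinuousLinearMap.adjoint_inner_left _ _ _

/-- If a stabilizer `g` of `ψ` anticommutes with `P` and commutes with `O`, then `Pψ` and `Oψ` are
orthogonal. -/
theorem inner_eq_zero_of_anticommute {g P O : QOp n} {ψ : QState n} (hg : g.IsHermitian)
    (hψ : g.toCLM ψ = ψ) (hP : g * P = (-1 : ℂ) • (P * g)) (hO : g * O = O * g) :
    inner ℂ (P.toCLM ψ) (O.toCLM ψ) = 0 := by
  have h1 : g.toCLM (P.toCLM ψ) = -P.toCLM ψ := by
    rw [← toCLM_mul_apply, hP, toCLM_smul_apply, toCLM_mul_apply, hψ, neg_one_smul]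
  have h2 : g.toCLM (O.toCLM ψ) = O.toCLM ψ := by
    rw [← toCLM_mul_apply, hO, toCLM_mul_apply, hψ]
  have h3 := inner_toCLM_of_isHermitian hg (P.toCLM ψ) (O.toCLM ψ)
  rw [h1, h2, inner_neg_left] at h3
  exact self_eq_neg.1 h3.symm

end QOp

/-! ### Stabilizers, distance and decoupling in code states -/

namespace CSSCode

open QOp

theorem smul_mem_of_zmod_two {n : ℕ} {S : Set (Bits n)} (h0 : 0 ∈ S) {a : Bits n} (ha : a ∈ S)
    (t : ZMod 2) : t • a ∈ S := by
  have : t = 0 ∨ t = 1 := by revert t; decide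
  rcases this with rfl | rfl
  · simpa using h0
  · simpa using ha

/-- Passes from generators to the whole stabilizer group: the exponents of Pauli operators fixing
`ψ` form a submonoid containing the rows. -/
theorem transpose_mulVec_mem {r n : ℕ} {S : AddSubmonoid (Bits n)}
    (M : Matrix (Fin r) (Fin n) (ZMod 2)) (h : ∀ j, M j ∈ S) (u : Bits r) : Mᵀ *ᵥ u ∈ S := by
  have : Mᵀ *ᵥ u = ∑ j, u j • M j := by
    rw [Matrix.mulVec_transpose]
    exact Matrix.vecMul_eq_sum u M
  rw [this]
  exact S.sum_mem fun j _ => smul_mem_of_zmod_two (S := (S : Set (Bits n))) S.zero_mem (h j) (u j)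

theorem pauliX_range_apply {C : CSSCode} {ψ : QState C.n} (hψ : C.IsCodeState ψ) (u : Bits C.nX) :
    (pauliX (C.hXᵀ *ᵥ u)).toCLM ψ = ψ :=
  transpose_mulVec_mem (S :=
    { carrier := {a | (pauliX a).toCLM ψ = ψ}
      zero_mem' := by simp [pauliX_zero, toCLM_one_apply]
      add_mem' := fun {a b} ha hb => by
        rw [Set.mem_ofPred_eq] at *
        rw [pauliX_add, toCLM_mul_apply, hb, ha] }) C.hX hψ.2.1 u

theorem pauliZ_range_apply {C : CSSCode} {ψ : QState C.n} (hψ : C.IsCodeState ψ) (v : Bits C.nZ) :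
    (pauliZ (C.hZᵀ *ᵥ v)).toCLM ψ = ψ :=
  transpose_mulVec_mem (S :=
    { carrier := {a | (pauliZ a).toCLM ψ = ψ}
      zero_mem' := by simp [pauliZ_zero, toCLM_one_apply]
      add_mem' := fun {a b} ha hb => by
        rw [Set.mem_ofPred_eq] at *
        rw [pauliZ_add, toCLM_mul_apply, hb, ha] }) C.hZ hψ.2.2 v

theorem not_isNontrivialLogical_of_card_lt {C : CSSCode} {a b : Bits C.n} {A : Finset (Fin C.n)}
    (hA : (A.card : ℕ∞) < C.distance) (ha : ∀ i ∉ A, a i = 0) (hb : ∀ i ∉ A, b i = 0) :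
    ¬ C.IsNontrivialLogical a b := by
  intro h
  have h1 : C.distance ≤ ((Finset.univ.filter fun i => a i ≠ 0 ∨ b i ≠ 0).card : ℕ∞) :=
    iInf_le_of_le a (iInf_le_of_le b (iInf_le_of_le h le_rfl))
  refine (hA.trans_le h1).not_ge (Nat.cast_le.2 (Finset.card_le_card fun i hi => ?_))
  by_contra hiA
  simp [ha i hiA, hb i hiA] at hi

/-- A Pauli operator of weight less than the distance either fixes all code states, or is
uncorrelated with all operators that avoid the support of some stabilizer generator. -/
theorem exists_finset_inner_pauli_eq_zero {C : CSSCode} {s : ℕ} (hC : C.IsLDPC s)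
    {ψ : QState C.n} (hψ : C.IsCodeState ψ) {a b : Bits C.n} (h : ¬ C.IsNontrivialLogical a b) :
    ∃ (T : Finset (Fin C.n)) (c : ℂ), T.card ≤ s ∧ ∀ O : QOp C.n, Disjoint O.supp T →
      inner ℂ (QOp.toCLM (pauliX a * pauliZ b) ψ - c • ψ) (O.toCLM ψ) = 0 := by
  have hone : ∀ t : ZMod 2, t ≠ 0 → (-1 : ℂ) ^ t.val = -1 := by
    intro t ht
    have : t = 1 := by revert t; decide
    simp [this, ZMod.val_one]
  have hvanish : ∀ {e : Bits C.n} {O : QOp C.n},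
      Disjoint O.supp (Finset.univ.filter fun i => e i ≠ 0) → ∀ i ∈ O.supp, e i = 0 := by
    intro e O hd i hi
    by_contra hne
    exact Finset.disjoint_left.1 hd hi (by simpa using hne)
  by_cases ha : C.hZ *ᵥ a = 0
  · by_cases hb : C.hX *ᵥ b = 0
    · have hst : (∃ u, a = C.hXᵀ *ᵥ u) ∧ (∃ v, b = C.hZᵀ *ᵥ v) := by
        by_contra hst
        exact h ⟨ha, hb, hst⟩
      obtain ⟨⟨u, rfl⟩, ⟨v, rfl⟩⟩ := hst
      -- The Pauli operator is a product of generators, so it fixes `ψ` and nothing has to be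
      -- avoided.
      refine ⟨∅, 1, by simp, fun O _ => ?_⟩
      rw [toCLM_mul_apply, pauliZ_range_apply hψ, pauliX_range_apply hψ, one_smul, sub_self,
        inner_zero_left]
    · obtain ⟨l, hl⟩ := Function.ne_iff.1 hb
      -- The violated check `l` anticommutes with the Pauli operator; its qubits are the ones to
      -- avoid.
      refine ⟨Finset.univ.filter fun i => C.hX l i ≠ 0, 0, hC.1 l, fun O hO => ?_⟩
      rw [zero_smul, sub_zero]
      refine inner_eq_zero_of_anticommute (isHermitian_pauliX _) (hψ.2.1 l) ?_
        (commute_pauliX (hvanish hO))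
      have hsign : (-1 : ℂ) ^ (b ⬝ᵥ C.hX l).val = -1 := by
        rw [dotProduct_comm]
        exact hone _ hl
      rw [mul_assoc, pauliZ_mul_pauliX, hsign, ← mul_assoc, ← pauliX_add, add_comm, pauliX_add,
        mul_smul_comm, smul_smul, neg_one_mul, neg_neg, one_smul, mul_assoc]
  · obtain ⟨l, hl⟩ := Function.ne_iff.1 ha
    refine ⟨Finset.univ.filter fun i => C.hZ l i ≠ 0, 0, hC.2 l, fun O hO => ?_⟩
    rw [zero_smul, sub_zero]
    refine inner_eq_zero_of_anticommute (isHermitian_pauliZ _) (hψ.2.2 l) ?_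
      (commute_pauliZ (hvanish hO))
    have hsign : (-1 : ℂ) ^ (C.hZ l ⬝ᵥ a).val = -1 := hone _ hl
    rw [← mul_assoc, pauliZ_mul_pauliX, hsign, smul_mul_assoc, mul_assoc, ← pauliZ_add, add_comm,
      pauliZ_add, mul_assoc]

/-- In a code state, an operator on fewer qubits than the distance is uncorrelated with all
operators that avoid a bounded set of qubits. -/
theorem exists_finset_inner_eq_zero {C : CSSCode} {s K : ℕ} (hC : C.IsLDPC s)
    (hK : (K : ℕ∞) < C.distance) {ψ : QState C.n} (hψ : C.IsCodeState ψ) {P : QOp C.n}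
    (hP : P.supp.card ≤ K) :
    ∃ T : Finset (Fin C.n), T.card ≤ 4 ^ K * s ∧ ∀ O : QOp C.n, Disjoint O.supp T →
      inner ℂ (P.toCLM ψ) (O.toCLM ψ) = inner ℂ (P.toCLM ψ) ψ * inner ℂ ψ (O.toCLM ψ) := by
  classical
  set A := P.supp with hA
  have hlog : ∀ p ∈ A.powerset ×ˢ A.powerset,
      ¬ C.IsNontrivialLogical (indicatorBits p.1) (indicatorBits p.2) := by
    intro p hp
    rw [Finset.mem_product, Finset.mem_powerset, Finset.mem_powerset] at hp
    refine not_isNontrivialLogical_of_card_lt ((Nat.cast_le.2 hP).trans_lt hK)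
      (fun i hi => if_neg fun h => hi (hp.1 h)) (fun i hi => if_neg fun h => hi (hp.2 h))
  choose! T c hT hc using fun p hp => exists_finset_inner_pauli_eq_zero hC hψ (hlog p hp)
  obtain ⟨d, hd⟩ := exists_eq_sum_pauli P
  set Q := A.powerset ×ˢ A.powerset with hQ
  have hsub : ∀ O : QOp C.n, Disjoint O.supp (Q.biUnion T) →
      inner ℂ (P.toCLM ψ - (∑ p ∈ Q, d p * c p) • ψ) (O.toCLM ψ) = 0 := by
    intro O hO
    have : P.toCLM ψ - (∑ p ∈ Q, d p * c p) • ψ = ∑ p ∈ Q, d p •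
        (QOp.toCLM (pauliX (indicatorBits p.1) * pauliZ (indicatorBits p.2)) ψ - c p • ψ) := by
      conv_lhs => rw [hd]
      simp only [toCLM_sum_apply, toCLM_smul_apply, Finset.sum_smul, smul_sub,
        Finset.sum_sub_distrib, mul_smul]
    rw [this, sum_inner]
    refine Finset.sum_eq_zero fun p hp => ?_
    rw [inner_smul_left, hc p hp O (Finset.disjoint_biUnion_right .. |>.1 hO p hp), mul_zero]
  refine ⟨Q.biUnion T, ?_, fun O hO => ?_⟩
  · refine (Finset.card_biUnion_le_card_mul _ _ s hT).trans (Nat.mul_le_mul_right s ?_)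
    rw [hQ, Finset.card_product, Finset.card_powerset, ← mul_pow]
    exact Nat.pow_le_pow_right (by norm_num) hP
  · have h1 := hsub O hO
    -- Testing against the identity, whose support is empty, identifies the conjugate of the scalar
    -- as `⟨Pψ, ψ⟩`.
    have h2 := hsub 1 (by simp [supp_one])
    rw [toCLM_one_apply, inner_sub_left, inner_smul_left, inner_self_eq_norm_sq_to_K, hψ.1] at h2
    rw [inner_sub_left, inner_smul_left, sub_eq_zero] at h1
    rw [h1, sub_eq_zero.1 h2]
    simp

end CSSCode

/-! ### Counting correlated pairs of terms -/

namespace LocalHamiltonian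

open QOp

variable {n m K : ℕ}

theorem isHermitian_total (H : LocalHamiltonian n m K) : H.total.IsHermitian := by
  rw [Matrix.IsHermitian, total, Matrix.conjTranspose_sum]
  exact Finset.sum_congr rfl fun j _ => (H.isHermitian j).eq

theorem norm_term_apply_le (H : LocalHamiltonian n m K) {ψ : QState n} (hψ : ‖ψ‖ = 1)
    (j : Fin m) : ‖(H.term j).toCLM ψ‖ ≤ 1 := by
  simpa [hψ] using (H.term j).toCLM.le_of_opNorm_le (H.norm_le_one j) ψ

open Classical in
/-- The number of terms that act on a given set of qubits. -/
theorem card_filter_not_disjoint_le (H : LocalHamiltonian n m K) (T : Finset (Fin n)) :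
    (Finset.univ.filter fun k => ¬ Disjoint (H.term k).supp T).card ≤ T.card * K := by
  have hsub : (Finset.univ.filter fun k => ¬ Disjoint (H.term k).supp T) ⊆
      T.biUnion fun i => Finset.univ.filter fun k => i ∈ (H.term k).supp := by
    intro k hk
    obtain ⟨i, hi, hiT⟩ := Finset.not_disjoint_iff.1 (Finset.mem_filter.1 hk).2
    exact Finset.mem_biUnion.2 ⟨i, hiT, by simpa using hi⟩
  refine (Finset.card_le_card hsub).trans (Finset.card_biUnion_le_card_mul _ _ K fun i _ => ?_)
  have := H.degree_le i
  rwa [Set.ncard_eq_toFinset_card', Set.toFinset_ofPred] at this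

/-- The covariance of two operators in the state `ψ`. -/
noncomputable def covariance (ψ : QState n) (P O : QOp n) : ℂ :=
  inner ℂ (P.toCLM ψ) (O.toCLM ψ) - inner ℂ (P.toCLM ψ) ψ * inner ℂ ψ (O.toCLM ψ)

/-- Covariance is sesquilinear, and `H.total` is Hermitian. Real parts appear because covariances of
noncommuting terms can be complex. -/
theorem qfi_total_eq (H : LocalHamiltonian n m K) (ψ : QState n) :
    qfi ψ H.total = ∑ j, ∑ k, (covariance ψ (H.term j) (H.term k)).re := by
  have hsum : ∑ j, ∑ k, covariance ψ (H.term j) (H.term k) = covariance ψ H.total H.total := by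
    simp only [covariance, total, toCLM_sum_apply, sum_inner, inner_sum, Finset.sum_sub_distrib,
      Finset.sum_mul_sum]
    rw [Finset.sum_comm]
  simp_rw [← Complex.re_sum]
  rw [hsum, covariance, qfi, toCLM_mul_apply, inner_toCLM_of_isHermitian H.isHermitian_total,
    Complex.sub_re, ← inner_conj_symm (H.total.toCLM ψ) ψ, Complex.conj_mul']
  norm_cast

theorem norm_covariance_le (H : LocalHamiltonian n m K) {ψ : QState n} (hψ : ‖ψ‖ = 1)
    (j k : Fin m) : ‖covariance ψ (H.term j) (H.term k)‖ ≤ 2 := by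
  have hj := H.norm_term_apply_le hψ j
  have hk := H.norm_term_apply_le hψ k
  have h1 := (norm_inner_le_norm (𝕜 := ℂ) ((H.term j).toCLM ψ) ((H.term k).toCLM ψ)).trans
    (mul_le_one₀ hj (norm_nonneg _) hk)
  have h2 := (norm_inner_le_norm (𝕜 := ℂ) ((H.term j).toCLM ψ) ψ).trans
    (mul_le_one₀ hj (norm_nonneg _) hψ.le)
  have h3 := (norm_inner_le_norm (𝕜 := ℂ) ψ ((H.term k).toCLM ψ)).trans
    (mul_le_one₀ hψ.le (norm_nonneg _) hk)
  have h4 := mul_le_one₀ h2 (norm_nonneg _) h3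
  rw [← norm_mul] at h4
  exact (norm_sub_le _ _).trans (by linarith)

/-- Linear bound on the quantum Fisher information of a code state of a single code. -/
theorem qfi_total_le {C : CSSCode} {s : ℕ} (hC : C.IsLDPC s) (hK : (K : ℕ∞) < C.distance)
    (H : LocalHamiltonian C.n m K) {ψ : QState C.n} (hψ : C.IsCodeState ψ) :
    qfi ψ H.total ≤ ((4 ^ K * s * K * 2 : ℕ) : ℝ) * m := by
  classical
  have hrow : ∀ j, ∑ k, (covariance ψ (H.term j) (H.term k)).re ≤
      ((4 ^ K * s * K * 2 : ℕ) : ℝ) := by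
    intro j
    obtain ⟨T, hT, hcov⟩ := C.exists_finset_inner_eq_zero hC hK hψ (H.card_supp_le j)
    -- Only terms meeting `T` survive: at most `4 ^ K * s * K` of them, each contributing at most
    -- `2`.
    rw [← Finset.sum_filter_of_ne (p := fun k => ¬ Disjoint (H.term k).supp T)]
    · refine (Finset.sum_le_card_nsmul _ _ 2 fun k _ =>
        (Complex.re_le_norm _).trans (H.norm_covariance_le hψ.1 j k)).trans ?_
      rw [nsmul_eq_mul, Nat.cast_mul _ 2, Nat.cast_ofNat]
      gcongr
      exact (H.card_filter_not_disjoint_le T).trans (Nat.mul_le_mul_right K hT)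
    · intro k _ hne hd
      refine hne ?_
      rw [covariance, hcov _ hd, sub_self, Complex.zero_re]
  rw [H.qfi_total_eq]
  refine (Finset.sum_le_card_nsmul _ _ _ fun j _ => hrow j).trans (le_of_eq ?_)
  rw [Finset.card_univ, Fintype.card_fin, nsmul_eq_mul, mul_comm]

end LocalHamiltonian

theorem theorem3 {ι : Type*} (𝒞 : ι → CSSCode) (s : ℕ)
    (hLDPC : ∀ i, (𝒞 i).IsLDPC s)
    (hdist : ∀ D : ℕ, ∀ᶠ i in manyQubits 𝒞, (D : ℕ∞) ≤ (𝒞 i).distance)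
    (hsys : WeakSystolicExpansion 𝒞)
    (hcosys : WeakCosystolicExpansion 𝒞)
    (K : ℕ) :
    ∃ C : ℝ, ∀ᶠ i in manyQubits 𝒞,
      ∀ (m : ℕ) (H : LocalHamiltonian (𝒞 i).n m K) (ψ : QState (𝒞 i).n),
        (𝒞 i).IsCodeState ψ → qfi ψ H.total ≤ C * m := by
  refine ⟨((4 ^ K * s * K * 2 : ℕ) : ℝ), ?_⟩
  -- Paulis on `K` qubits must weigh strictly less than the distance, hence `K + 1`.
  filter_upwards [hdist (K + 1)] with i hi m H ψ hψ
  exact H.qfi_total_le (hLDPC i) ((Nat.cast_lt.2 K.lt_succ_self).trans_le hi) hψ
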